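/- Let $\mathbb{F}_q$ be a finite field and let $\mathcal{C}\subseteq\mathbb{F}_q^n$ be a linear code. For a word $\mathbf{a}\in\mathbb{F}_q^n$ let $\operatorname{supp}(\mathbf{a})=\{i : a_i\neq 0\}$ and let $w(\mathbf{a})=|\operatorname{supp}(\mathbf{a})|$ be its Hamming weight. For a subspace $D\subseteq\mathbb{F}_q^n$ let $w(D)=|\bigcup_{\mathbf{c}\in D}\operatorname{supp}(\mathbf{c})|$, and let $d_r(\mathcal{C})=\min\{w(D) : D\subseteq\mathcal{C} \text{ a subspace},\ \dim D=r\}$ be the $r$-th generalized Hamming weight. A nonzero codeword of $\mathcal{C}$ has minimal support if its support does not properly contain the support of any other nonzero codeword. Let $M$ be a set of codewords of $\mathcal{C}$ of minimal support, and suppose that the set $S_M=\{\operatorname{supp}(\mathbf{c}) : \mathbf{c}\in M\}$ has at least two elements. Let $K$ be any field, let $R=K[x_1,\dots,x_n]$ with the standard grading, and let $I_M\subseteq R$ be the ideal generated by the monomials $\prod_{i\in\sigma}x_i$, $\sigma\in S_M$. Then $R/I_M$ has a minimal graded free resolution $\cdots\to F_2\to F_1\to F_0\to R/I_M\to 0$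 with all $F_i=\bigoplus_{j} R(-j)^{\beta_{i,j}(R/I_M)}$ of finite rank, and for every such resolution the following holds. 1. $\min\{j : \beta_{1,j}(R/I_M)\neq 0\}=d_1(\mathcal{C})$ if and only if $M$ contains a codeword of minimum Hamming weight, that is, of weight $\min\{w(\mathbf{a}) : \mathbf{0}\neq\mathbf{a}\in\mathcal{C}\}$. 2. $\min\{j : \beta_{2,j}(R/I_M)\neq 0\}=d_2(\mathcal{C})$ if and only if $M$ is a $d_2$-test set of $\mathcal{C}$, that is, there are $\mathbf{c}_1,\mathbf{c}_2\in M$ such that $\dim\langle\mathbf{c}_1,\mathbf{c}_2\rangle=2$ and $w(\langle\mathbf{c}_1,\mathbf{c}_2\rangle)=d_2(\mathcal{C})$. -/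

import Mathlib

open scoped Classical in
/-- The support of a word. -/
noncomputable def wordSupport {F : Type*} [Field F] {n : ℕ} (c : Fin n → F) : Finset (Fin n) :=
  Finset.univ.filter fun i => c i ≠ 0

/-- The Hamming weight of a word: the cardinality of its support. -/
noncomputable def wordWeight {F : Type*} [Field F] {n : ℕ} (c : Fin n → F) : ℕ :=
  (wordSupport c).card

/-- The minimum Hamming weight of a nonzero codeword of `C`. -/
noncomputable def minimumWeight {F : Type*} [Field F] {n : ℕ}
    (C : Submodule F (Fin n → F)) : ℕ :=
  sInf {w | ∃ a ∈ C, a ≠ 0 ∧ wordWeight a = w}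

/-- The support of a space of words: the positions where some word of it is nonzero. -/
def spaceSupport {F : Type*} [Field F] {n : ℕ} (D : Submodule F (Fin n → F)) : Set (Fin n) :=
  {i | ∃ c ∈ D, i ∈ wordSupport c}

/-- The weight of a space of words. -/
noncomputable def spaceWeight {F : Type*} [Field F] {n : ℕ}
    (D : Submodule F (Fin n → F)) : ℕ :=
  (spaceSupport D).ncard

/-- The `r`-th generalized Hamming weight of `C` (meaningful for `r ≤ dim C`). -/
noncomputable def generalizedHammingWeight {F : Type*} [Field F] {n : ℕ}
    (C : Submodule F (Fin n → F)) (r : ℕ) : ℕ :=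
  sInf {w | ∃ D : Submodule F (Fin n → F), D ≤ C ∧ Module.finrank F D = r ∧ spaceWeight D = w}

/-- The nonzero codewords of minimal support. -/
def minimalSupportCodewords {F : Type*} [Field F] {n : ℕ}
    (C : Submodule F (Fin n → F)) : Set (Fin n → F) :=
  {c | c ∈ C ∧ c ≠ 0 ∧ ∀ c' ∈ C, c' ≠ 0 → ¬ wordSupport c' ⊂ wordSupport c}

/-- `M` is a `d₂`-test set of `C`. -/
def IsD2TestSet {F : Type*} [Field F] {n : ℕ}
    (C : Submodule F (Fin n → F)) (M : Set (Fin n → F)) : Prop :=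
  M ⊆ minimalSupportCodewords C ∧
    ∃ c₁ ∈ M, ∃ c₂ ∈ M,
      Module.finrank F (Submodule.span F {c₁, c₂}) = 2 ∧
        spaceWeight (Submodule.span F {c₁, c₂}) = generalizedHammingWeight C 2

/-- The set `S_M` of supports of the words in `M`. -/
def supportSet {F : Type*} [Field F] {n : ℕ} (M : Set (Fin n → F)) : Set (Finset (Fin n)) :=
  {σ | ∃ c ∈ M, wordSupport c = σ}

/-- The squarefree monomial ideal `I_M` of `K[x₁, …, xₙ]` generated by the monomials `x^σ`,
`σ ∈ S_M`. -/
noncomputable def supportIdeal (K : Type*) [Field K] {F : Type*} [Field F] {n : ℕ}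
    (M : Set (Fin n → F)) : Ideal (MvPolynomial (Fin n) K) :=
  Ideal.span {f | ∃ σ ∈ supportSet M, f = ∏ i ∈ σ, MvPolynomial.X i}

/-- An element `v` of the graded free module `⨁ₐ R(-deg a)` is homogeneous of degree `j`:
each component `v a` is a homogeneous polynomial of degree `j - deg a` (zero if `j < deg a`). -/
def IsHomogeneousVector {K : Type*} [Field K] {n r : ℕ} (deg : Fin r → ℕ)
    (v : Fin r → MvPolynomial (Fin n) K) (j : ℕ) : Prop :=
  ∀ a, ∀ m : Fin n →₀ ℕ, (v a).coeff m ≠ 0 → m.degree + deg a = j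

/-- A minimal graded free resolution
`⋯ → F₂ → F₁ → F₀ → R/I → 0` of `R/I`, `R = K[x₁, …, xₙ]` with the standard grading,
where `Fᵢ = ⨁ₐ R(-degree i a)` is a graded free module of finite rank `rank i`. -/
structure MinimalGradedFreeResolution {K : Type*} [Field K] {n : ℕ}
    (I : Ideal (MvPolynomial (Fin n) K)) where
  /-- the rank of `Fᵢ` -/
  rank : ℕ → ℕ
  /-- the degrees of the basis elements of `Fᵢ` -/
  degree : ∀ i, Fin (rank i) → ℕ
  /-- the augmentation `F₀ → R/I` -/
  aug : (Fin (rank 0) → MvPolynomial (Fin n) K) →ₗ[MvPolynomial (Fin n) K]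
    MvPolynomial (Fin n) K ⧸ I
  /-- the differential `Fᵢ₊₁ → Fᵢ` -/
  d : ∀ i, (Fin (rank (i + 1)) → MvPolynomial (Fin n) K) →ₗ[MvPolynomial (Fin n) K]
    (Fin (rank i) → MvPolynomial (Fin n) K)
  /-- the augmentation preserves degrees -/
  aug_homogeneous : ∀ v j, IsHomogeneousVector (degree 0) v j →
    ∃ f : MvPolynomial (Fin n) K, f.IsHomogeneous j ∧ aug v = Ideal.Quotient.mk I f
  /-- the differentials preserve degrees -/
  d_homogeneous : ∀ i v j, IsHomogeneousVector (degree (i + 1)) v j →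
    IsHomogeneousVector (degree i) (d i v) j
  /-- exactness at `R/I` -/
  aug_surjective : Function.Surjective aug
  /-- exactness at `F₀` -/
  exact_zero : Function.Exact (d 0) aug
  /-- exactness at `Fᵢ₊₁` -/
  exact_succ : ∀ i, Function.Exact (d (i + 1)) (d i)
  /-- minimality: the image of `Fᵢ₊₁` lies in `(x₁, …, xₙ) Fᵢ` -/
  minimal : ∀ i v a, d i v a ∈ MvPolynomial.idealOfVars (Fin n) K

/-- The graded Betti number `β_{i,j}`: the number of summands `R(-j)` of `Fᵢ`. -/
def MinimalGradedFreeResolution.betti {K : Type*} [Field K] {n : ℕ}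
    {I : Ideal (MvPolynomial (Fin n) K)} (𝓕 : MinimalGradedFreeResolution I) (i j : ℕ) : ℕ :=
  (Finset.univ.filter fun a : Fin (𝓕.rank i) => 𝓕.degree i a = j).card

/-!
The two least degrees in question do not depend on the resolution. The least degree in which `F₁`
has a generator is the least degree of a nonzero element of `I`, and since two minimal systems of
homogeneous generators of the same graded module are related by maps that are injective modulo
`(x₁, …, xₙ)`, the least degree in which `F₂` has a generator is the least degree of a nonzero
syzygy of any minimal system of homogeneous generators of `I`. For an antichain of monomials the
cancelling terms of such a syzygy show that the latter is the least degree of `lcm(u, v)`, where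
`u ≠ v` are generators.

For squarefree monomials `x^σ` and `x^τ` these degrees are `|σ|` and `|σ ∪ τ|`. Two codewords of
minimal support are proportional if and only if they have the same support, so the numbers
`|σ ∪ τ|` are the weights of the planes spanned by two codewords in `M`. As `d₁` and `d₂` are lower
bounds of these degrees, they are the minima if and only if they are attained.
-/

open MvPolynomial

theorem isLeast_iff_of_subset_of_isCoinitialFor {α : Type*} [PartialOrder α] {A B : Set α}
    (hAB : A ⊆ B) (hBA : IsCoinitialFor B A) {d : α} : IsLeast A d ↔ IsLeast B d := by
  refine ⟨fun h => ⟨hAB h.1, fun b hb => ?_⟩, fun h => ?_⟩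
  · obtain ⟨a, ha, hab⟩ := hBA hb
    exact (h.2 ha).trans hab
  · obtain ⟨a, ha, had⟩ := hBA h.1
    exact ⟨had.antisymm (h.2 (hAB ha)) ▸ ha, fun b hb => h.2 (hAB hb)⟩

-- The determinant of `L` is mapped to that of the identity, so it is nonzero.
theorem injective_of_map_apply_eq {R S ι : Type*} [CommRing R] [IsDomain R] [CommRing S]
    [Nontrivial S] [Finite ι] (f : R →+* S) {L : (ι → R) →ₗ[R] (ι → R)}
    (h : ∀ v a, f (L v a) = f (v a)) : Function.Injective L := by
  classical
  have := Fintype.ofFinite ι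
  have map_toMatrix' : L.toMatrix'.map f = 1 := by
    ext a b
    rw [Matrix.map_apply, LinearMap.toMatrix'_apply, h, Matrix.one_apply, Pi.single_apply]
    split_ifs <;> simp
  have det_ne_zero : L.toMatrix'.det ≠ 0 := fun h0 => by
    have map_det_eq_one : f L.toMatrix'.det = 1 := by
      rw [RingHom.map_det, RingHom.mapMatrix_apply, map_toMatrix', Matrix.det_one]
    exact one_ne_zero (map_det_eq_one.symm.trans (by rw [h0, map_zero]))
  refine (injective_iff_map_eq_zero L).2 fun v hv => Matrix.eq_zero_of_mulVec_eq_zero det_ne_zero ?_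
  rw [LinearMap.toMatrix'_mulVec, hv]

theorem span_range_succAbove_eq {R E : Type*} [Ring R] [AddCommGroup E] [Module R E]
    {s : ℕ} {z : Fin (s + 1) → E} {w : Fin (s + 1) → R} {b : Fin (s + 1)}
    (hw : ∑ a, w a • z a = 0) (hb : IsUnit (w b)) :
    Submodule.span R (Set.range (z ∘ b.succAbove)) = Submodule.span R (Set.range z) := by
  refine le_antisymm (Submodule.span_mono (Set.range_comp_subset_range _ _)) ?_
  rw [Submodule.span_le]
  rintro _ ⟨a, rfl⟩
  obtain rfl | ⟨a, rfl⟩ := b.eq_self_or_eq_succAbove a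
  · rw [Fin.sum_univ_succAbove _ a] at hw
    rw [SetLike.mem_coe, ← Submodule.smul_mem_iff_of_isUnit _ hb, eq_neg_of_add_eq_zero_left hw]
    exact Submodule.neg_mem _ (Submodule.sum_mem _ fun i _ =>
      Submodule.smul_mem _ _ (Submodule.subset_span ⟨i, rfl⟩))
  · exact Submodule.subset_span ⟨a, rfl⟩

theorem mem_idealOfVars_iff_constantCoeff {σ A : Type*} [CommSemiring A] {p : MvPolynomial σ A} :
    p ∈ idealOfVars σ A ↔ constantCoeff p = 0 := by
  rw [← pow_one (idealOfVars σ A), mem_pow_idealOfVars_iff']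
  simp [Finsupp.degree_eq_zero_iff, constantCoeff_eq]

theorem isHomogeneous_iff_degree_eq {σ A : Type*} [CommSemiring A] {p : MvPolynomial σ A} {i : ℕ} :
    p.IsHomogeneous i ↔ ∀ m, p.coeff m ≠ 0 → m.degree = i := by
  rw [Finsupp.degree_eq_weight_one]
  rfl

section GradedFreeModules

variable {K : Type*} [Field K] {n r s t : ℕ} {deg : Fin r → ℕ} {deg' : Fin s → ℕ} {i j : ℕ}

local notation "R" => MvPolynomial (Fin n) K

namespace IsHomogeneousVector

variable {v w : Fin r → MvPolynomial (Fin n) K}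

theorem zero : IsHomogeneousVector deg (0 : Fin r → R) j := fun a m hm => by
  simp at hm

theorem add (hv : IsHomogeneousVector deg v j) (hw : IsHomogeneousVector deg w j) :
    IsHomogeneousVector deg (v + w) j := fun a m hm => by
  by_cases hvm : (v a).coeff m = 0
  · exact hw a m fun hwm => hm (by simp [hvm, hwm])
  · exact hv a m hvm

theorem smul {p : R} (hp : p.IsHomogeneous i) (hv : IsHomogeneousVector deg v j) :
    IsHomogeneousVector deg (p • v) (i + j) := fun a m hm => by
  rw [Pi.smul_apply, smul_eq_mul, coeff_mul] at hm
  obtain ⟨⟨x, y⟩, hxy, hne⟩ := Finset.exists_ne_zero_of_sum_ne_zero hm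
  rw [← Finset.HasAntidiagonal.mem_antidiagonal.1 hxy, map_add, add_assoc,
    isHomogeneous_iff_degree_eq.1 hp x (left_ne_zero_of_mul hne),
    hv a y (right_ne_zero_of_mul hne)]

theorem sum {ι : Type*} {S : Finset ι} {v : ι → Fin r → R}
    (hv : ∀ k ∈ S, IsHomogeneousVector deg (v k) j) :
    IsHomogeneousVector deg (∑ k ∈ S, v k) j :=
  Finset.sum_induction _ (IsHomogeneousVector deg · j) (fun _ _ => add) zero hv

theorem isHomogeneous_apply (hv : IsHomogeneousVector deg v j) {a : Fin r}
    (h : i + deg a = j) : (v a).IsHomogeneous i :=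
  isHomogeneous_iff_degree_eq.2 fun m hm => Nat.add_right_cancel ((hv a m hm).trans h.symm)

theorem apply_eq_zero_of_lt (hv : IsHomogeneousVector deg v j) {a : Fin r} (h : j < deg a) :
    v a = 0 := by
  ext m
  exact of_not_not fun hm => by have := hv a m hm; omega

theorem exists_degree_le (hv : IsHomogeneousVector deg v j) (hv0 : v ≠ 0) : ∃ a, deg a ≤ j := by
  obtain ⟨a, ha⟩ := Function.ne_iff.1 hv0
  exact ⟨a, not_lt.1 fun h => ha (hv.apply_eq_zero_of_lt h)⟩

end IsHomogeneousVector

theorem isHomogeneousVector_zero_iff {v : Fin r → R} :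
    IsHomogeneousVector 0 v j ↔ ∀ a, (v a).IsHomogeneous j :=
  forall_congr' fun _ => isHomogeneous_iff_degree_eq.symm

theorem isHomogeneousVector_single (deg : Fin r → ℕ) (a : Fin r) :
    IsHomogeneousVector deg (Pi.single a (1 : R)) (deg a) := fun b m hm => by
  obtain rfl | hba := eq_or_ne b a
  · rw [Pi.single_eq_same, coeff_one] at hm
    obtain rfl : 0 = m := of_not_not fun h0 => hm (if_neg h0)
    simp
  · simp [Pi.single_eq_of_ne hba] at hm

/-- The component of degree `j` of a vector in the graded free module `⨁ₐ R(-deg a)`. -/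
noncomputable def vectorComponent (deg : Fin r → ℕ) (j : ℕ) : (Fin r → R) →+ (Fin r → R) where
  toFun v a := if deg a ≤ j then homogeneousComponent (j - deg a) (v a) else 0
  map_zero' := by ext; simp
  map_add' v w := by ext a : 1; simp only [Pi.add_apply]; split_ifs <;> simp

theorem coeff_vectorComponent (v : Fin r → R) (a : Fin r) (m : Fin n →₀ ℕ) :
    (vectorComponent deg j v a).coeff m = if m.degree + deg a = j then (v a).coeff m else 0 := by
  change coeff m (if deg a ≤ j then homogeneousComponent (j - deg a) (v a) else 0) = _
  by_cases h : deg a ≤ j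
  · rw [if_pos h, coeff_homogeneousComponent]
    exact if_congr (by omega) rfl rfl
  · rw [if_neg h, if_neg (by omega), coeff_zero]

theorem vectorComponent_degree_apply (v : Fin r → R) (a : Fin r) :
    vectorComponent deg (deg a) v a = C (constantCoeff (v a)) := by
  ext m
  simp only [coeff_vectorComponent, coeff_C, constantCoeff_eq, Nat.add_eq_right,
    Finsupp.degree_eq_zero_iff, eq_comm (a := m)]
  split_ifs with h
  · rw [← h]
  · rfl

theorem isHomogeneousVector_vectorComponent (deg : Fin r → ℕ) (j : ℕ) (v : Fin r → R) :
    IsHomogeneousVector deg (vectorComponent deg j v) j := fun a m hm => by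
  rw [coeff_vectorComponent] at hm
  exact of_not_not fun h => hm (if_neg h)

theorem IsHomogeneousVector.vectorComponent_eq {v : Fin r → R}
    (hv : IsHomogeneousVector deg v i) : vectorComponent deg j v = if i = j then v else 0 := by
  ext a m
  rw [coeff_vectorComponent]
  by_cases hm : (v a).coeff m = 0
  · split_ifs <;> simp [hm]
  · rw [hv a m hm]
    split_ifs <;> simp

theorem exists_sum_vectorComponent_eq (deg : Fin r → ℕ) (v : Fin r → R) :
    ∃ N, ∑ j ∈ Finset.range N, vectorComponent deg j v = v := by
  refine ⟨Finset.univ.sup (fun a => (v a).totalDegree + deg a) + 1, ?_⟩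
  ext a m
  simp only [Finset.sum_apply, coeff_sum, coeff_vectorComponent, Finset.sum_ite_eq,
    Finset.mem_range, Nat.lt_succ_iff]
  refine ite_eq_left_iff.2 fun h => by_contra fun hm => h ?_
  have degree_le : m.degree ≤ (v a).totalDegree :=
    le_totalDegree (mem_support_iff.2 (Ne.symm hm))
  exact (Nat.add_le_add_right degree_le _).trans
    (Finset.le_sup (f := fun a => (v a).totalDegree + deg a) (Finset.mem_univ a))

/-- A linear map of graded free modules preserving degrees. -/
def IsHomogeneousMap (deg : Fin r → ℕ) (deg' : Fin s → ℕ)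
    (L : (Fin r → R) →ₗ[R] (Fin s → R)) : Prop :=
  ∀ v j, IsHomogeneousVector deg v j → IsHomogeneousVector deg' (L v) j

/-- A graded submodule of the graded free module `⨁ₐ R(-deg a)`: one containing the homogeneous
components of its elements. -/
def IsGradedSubmodule (deg : Fin r → ℕ) (N : Submodule R (Fin r → R)) : Prop :=
  ∀ v ∈ N, ∀ j, vectorComponent deg j v ∈ N

/-- The degrees of the nonzero homogeneous elements of a submodule of `⨁ₐ R(-deg a)`. -/
def degreeSet (deg : Fin r → ℕ) (N : Submodule R (Fin r → R)) : Set ℕ :=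
  {j | ∃ v ∈ N, v ≠ 0 ∧ IsHomogeneousVector deg v j}

theorem isHomogeneousMap_linearCombination {z : Fin r → Fin s → R}
    (hz : ∀ a, IsHomogeneousVector deg' (z a) (deg a)) :
    IsHomogeneousMap deg deg' (Fintype.linearCombination R z) := fun v j hv => by
  rw [Fintype.linearCombination_apply]
  refine .sum fun a _ => ?_
  obtain haj | hja := le_or_gt (deg a) j
  · have hva := hv.isHomogeneous_apply (Nat.sub_add_cancel haj)
    simpa only [Nat.sub_add_cancel haj] using (hz a).smul hva
  · rw [hv.apply_eq_zero_of_lt hja, zero_smul]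
    exact .zero

namespace IsHomogeneousMap

variable {L : (Fin r → MvPolynomial (Fin n) K) →ₗ[MvPolynomial (Fin n) K]
  (Fin s → MvPolynomial (Fin n) K)}

theorem vectorComponent_map (hL : IsHomogeneousMap deg deg' L) (v : Fin r → R) (j : ℕ) :
    vectorComponent deg' j (L v) = L (vectorComponent deg j v) := by
  obtain ⟨N, hN⟩ := exists_sum_vectorComponent_eq deg v
  rw [← hN]
  simp only [map_sum]
  refine Finset.sum_congr rfl fun i _ => ?_
  have hv := isHomogeneousVector_vectorComponent deg i v
  rw [(hL _ _ hv).vectorComponent_eq, hv.vectorComponent_eq]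
  split_ifs <;> simp

theorem isGradedSubmodule_ker (hL : IsHomogeneousMap deg deg' L) :
    IsGradedSubmodule deg (LinearMap.ker L) := fun v hv j => by
  rw [LinearMap.mem_ker] at hv ⊢
  rw [← hL.vectorComponent_map, hv, map_zero]

theorem exists_preimage (hL : IsHomogeneousMap deg deg' L) {w : Fin s → R}
    (hw : IsHomogeneousVector deg' w j) (hwL : w ∈ LinearMap.range L) :
    ∃ v, IsHomogeneousVector deg v j ∧ L v = w := by
  obtain ⟨v, rfl⟩ := hwL
  refine ⟨vectorComponent deg j v, isHomogeneousVector_vectorComponent _ _ _, ?_⟩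
  rw [← hL.vectorComponent_map, hw.vectorComponent_eq, if_pos rfl]

theorem exists_lift {deg'' : Fin t → ℕ} {L' : (Fin t → R) →ₗ[R] (Fin s → R)}
    (hL : IsHomogeneousMap deg deg' L) (hL' : IsHomogeneousMap deg'' deg' L')
    (hle : LinearMap.range L ≤ LinearMap.range L') :
    ∃ Q, IsHomogeneousMap deg deg'' Q ∧ L' ∘ₗ Q = L := by
  have exists_preimage_single a : ∃ u, IsHomogeneousVector deg'' u (deg a) ∧
      L' u = L (Pi.single a 1) :=
    hL'.exists_preimage (hL _ _ (isHomogeneousVector_single deg a)) (hle ⟨_, rfl⟩)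
  choose u hu hL'u using exists_preimage_single
  refine ⟨Fintype.linearCombination R u, isHomogeneousMap_linearCombination hu, ?_⟩
  refine LinearMap.pi_ext' fun a => LinearMap.ext_ring ?_
  simp [Fintype.linearCombination_apply_single, hL'u]

end IsHomogeneousMap

theorem IsGradedSubmodule.exists_homogeneous_generators {N : Submodule R (Fin r → R)}
    (hN : IsGradedSubmodule deg N) :
    ∃ (s : ℕ) (deg' : Fin s → ℕ) (z : Fin s → Fin r → R),
      (∀ a, IsHomogeneousVector deg (z a) (deg' a)) ∧ Submodule.span R (Set.range z) = N := by
  classical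
  obtain ⟨S, hS⟩ := IsNoetherian.noetherian N
  choose B hB using fun v : Fin r → R => exists_sum_vectorComponent_eq deg v
  let e := (S.sigma fun v => Finset.range (B v)).equivFin.symm
  refine ⟨_, fun a => (e a).1.2, fun a => vectorComponent deg (e a).1.2 (e a).1.1,
    fun a => isHomogeneousVector_vectorComponent _ _ _, le_antisymm ?_ ?_⟩
  · rw [Submodule.span_le]
    rintro _ ⟨a, rfl⟩
    exact hN _ (hS ▸ Submodule.subset_span (Finset.mem_sigma.1 (e a).2).1) _
  · rw [← hS, Submodule.span_le]
    intro v hv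
    rw [SetLike.mem_coe, ← hB v]
    refine Submodule.sum_mem _ fun j hj => Submodule.subset_span ?_
    exact ⟨e.symm ⟨⟨v, j⟩, Finset.mem_sigma.2 ⟨hv, hj⟩⟩, by simp only [Equiv.apply_symm_apply]⟩

end GradedFreeModules

section MinimalCovers

variable {K : Type*} [Field K] {n r s t : ℕ} {deg : Fin r → ℕ} {deg' : Fin s → ℕ}
  {deg'' : Fin t → ℕ}

local notation "R" => MvPolynomial (Fin n) K

/-- `L` presents the submodule `N` of `⨁ₐ R(-deg' a)` by a minimal system of homogeneous
generators, of degrees `deg`. Minimality is the condition `ker L ⊆ (x₁, …, xₙ) ⨁ₐ R(-deg a)`. -/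
structure IsMinimalCover (deg : Fin r → ℕ) (deg' : Fin s → ℕ) (N : Submodule R (Fin s → R))
    (L : (Fin r → R) →ₗ[R] (Fin s → R)) : Prop where
  homogeneous : IsHomogeneousMap deg deg' L
  range_eq : LinearMap.range L = N
  constantCoeff_eq_zero : ∀ v ∈ LinearMap.ker L, ∀ a, constantCoeff (v a) = 0

namespace IsMinimalCover

variable {N : Submodule (MvPolynomial (Fin n) K) (Fin s → MvPolynomial (Fin n) K)}
  {L : (Fin r → MvPolynomial (Fin n) K) →ₗ[MvPolynomial (Fin n) K]
    (Fin s → MvPolynomial (Fin n) K)}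
  {L' : (Fin t → MvPolynomial (Fin n) K) →ₗ[MvPolynomial (Fin n) K]
    (Fin s → MvPolynomial (Fin n) K)}

theorem apply_single_ne_zero (hL : IsMinimalCover deg deg' N L) (a : Fin r) :
    L (Pi.single a 1) ≠ 0 := fun h => by
  simpa using hL.constantCoeff_eq_zero _ h a

theorem isLeast_range_degree_iff (hL : IsMinimalCover deg deg' N L) {d : ℕ} :
    IsLeast (Set.range deg) d ↔ IsLeast (degreeSet deg' N) d := by
  refine isLeast_iff_of_subset_of_isCoinitialFor ?_ ?_
  · rintro _ ⟨a, rfl⟩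
    exact ⟨L (Pi.single a 1), hL.range_eq ▸ LinearMap.mem_range_self L _,
      hL.apply_single_ne_zero a, hL.homogeneous _ _ (isHomogeneousVector_single deg a)⟩
  · rintro j ⟨v, hvN, hv0, hvj⟩
    obtain ⟨u, huj, rfl⟩ := hL.homogeneous.exists_preimage hvj (hL.range_eq.symm ▸ hvN)
    obtain ⟨a, ha⟩ := huj.exists_degree_le (ne_of_apply_ne L (by rwa [map_zero]))
    exact ⟨deg a, ⟨a, rfl⟩, ha⟩

-- Factor `L = L' ∘ Q` and `L' = L ∘ P`. By minimality of `L` the endomorphism `P ∘ Q` is the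
-- identity modulo `(x₁, …, xₙ)`, so `Q` is injective, and it maps `ker L` to `ker L'`.
theorem degreeSet_ker_subset (hL : IsMinimalCover deg deg' N L)
    (hL' : IsMinimalCover deg'' deg' N L') :
    degreeSet deg (LinearMap.ker L) ⊆ degreeSet deg'' (LinearMap.ker L') := by
  obtain ⟨Q, hQ, hL'Q⟩ := hL.homogeneous.exists_lift hL'.homogeneous
    (hL.range_eq.trans hL'.range_eq.symm).le
  obtain ⟨P, -, hLP⟩ := hL'.homogeneous.exists_lift hL.homogeneous
    (hL'.range_eq.trans hL.range_eq.symm).le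
  have constantCoeff_PQ v a : constantCoeff ((P ∘ₗ Q) v a) = constantCoeff (v a) := by
    have mem_ker : P (Q v) - v ∈ LinearMap.ker L := by
      rw [LinearMap.mem_ker, map_sub, ← LinearMap.comp_apply L P, hLP,
        ← LinearMap.comp_apply L' Q, hL'Q, sub_self]
    simpa [sub_eq_zero] using hL.constantCoeff_eq_zero _ mem_ker a
  have Q_injective : Function.Injective Q :=
    .of_comp (f := P) (injective_of_map_apply_eq (L := P ∘ₗ Q) constantCoeff constantCoeff_PQ)
  rintro j ⟨v, hv, hv0, hvj⟩
  refine ⟨Q v, ?_, (map_ne_zero_iff Q Q_injective).2 hv0, hQ v j hvj⟩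
  rwa [LinearMap.mem_ker, ← LinearMap.comp_apply, hL'Q]

theorem degreeSet_ker_eq (hL : IsMinimalCover deg deg' N L)
    (hL' : IsMinimalCover deg'' deg' N L') :
    degreeSet deg (LinearMap.ker L) = degreeSet deg'' (LinearMap.ker L') :=
  (hL.degreeSet_ker_subset hL').antisymm (hL'.degreeSet_ker_subset hL)

end IsMinimalCover

-- The component of degree `deg b` of the relation `w` has the unit `constantCoeff (w b)` at `b`.
theorem span_range_succAbove_eq_of_homogeneous {deg : Fin (r + 1) → ℕ}
    {z : Fin (r + 1) → Fin s → R} (hz : ∀ a, IsHomogeneousVector deg' (z a) (deg a))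
    {w : Fin (r + 1) → R} (hw : w ∈ LinearMap.ker (Fintype.linearCombination R z))
    {b : Fin (r + 1)} (hb : constantCoeff (w b) ≠ 0) :
    Submodule.span R (Set.range (z ∘ b.succAbove)) = Submodule.span R (Set.range z) := by
  have component_mem := (isHomogeneousMap_linearCombination hz).isGradedSubmodule_ker w hw (deg b)
  refine span_range_succAbove_eq component_mem ?_
  rw [vectorComponent_degree_apply]
  exact hb.isUnit.map C

theorem IsGradedSubmodule.exists_isMinimalCover {N : Submodule R (Fin s → R)}
    (hN : IsGradedSubmodule deg' N) :
    ∃ (r : ℕ) (deg : Fin r → ℕ) (L : (Fin r → R) →ₗ[R] (Fin s → R)),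
      IsMinimalCover deg deg' N L := by
  classical
  have exists_generators := hN.exists_homogeneous_generators
  obtain ⟨deg, z, hz, hspan⟩ := Nat.find_spec exists_generators
  have card_minimal := fun k => Nat.find_min (m := k) exists_generators
  generalize Nat.find exists_generators = r at *
  refine ⟨r, deg, Fintype.linearCombination R z, isHomogeneousMap_linearCombination hz,
    (Fintype.range_linearCombination R z).trans hspan, fun w hw b => ?_⟩
  by_contra hb
  obtain _ | r := r
  · exact b.elim0
  · exact card_minimal r r.lt_succ_self ⟨deg ∘ b.succAbove, z ∘ b.succAbove, fun a => hz _,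
      (span_range_succAbove_eq_of_homogeneous hz hw hb).trans hspan⟩

end MinimalCovers

section Existence

attribute [local instance] gradedAlgebra

variable {K : Type*} [Field K] {n : ℕ} {I : Ideal (MvPolynomial (Fin n) K)}

local notation "R" => MvPolynomial (Fin n) K

theorem constantCoeff_eq_zero_of_mem (hI : I.IsHomogeneous (homogeneousSubmodule (Fin n) K))
    (hI' : I ≠ ⊤) {p : R} (hp : p ∈ I) : constantCoeff p = 0 := by
  by_contra hp0
  refine hI' (I.eq_top_of_isUnit_mem ?_ ((Ne.isUnit hp0).map C))
  rw [constantCoeff_eq, ← homogeneousComponent_zero]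
  exact homogeneousComponent_mem_of_mem hI hp 0

/-- A candidate for a syzygy module in a minimal resolution: a graded submodule of a graded free
module `F` of finite rank which is contained in `(x₁, …, xₙ) F`. -/
structure SyzygyModule (K : Type*) [Field K] (n : ℕ) where
  rank : ℕ
  degree : Fin rank → ℕ
  carrier : Submodule (MvPolynomial (Fin n) K) (Fin rank → MvPolynomial (Fin n) K)
  graded : IsGradedSubmodule degree carrier
  constantCoeff_eq_zero : ∀ v ∈ carrier, ∀ a, constantCoeff (v a) = 0

namespace SyzygyModule

theorem exists_isMinimalCover (Z : SyzygyModule K n) :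
    ∃ (Z' : SyzygyModule K n) (L : (Fin Z'.rank → R) →ₗ[R] (Fin Z.rank → R)),
      IsMinimalCover Z'.degree Z.degree Z.carrier L ∧ LinearMap.ker L = Z'.carrier := by
  obtain ⟨r, deg, L, hL⟩ := Z.graded.exists_isMinimalCover
  exact ⟨⟨r, deg, LinearMap.ker L, hL.homogeneous.isGradedSubmodule_ker, hL.constantCoeff_eq_zero⟩,
    L, hL, rfl⟩

/-- A proper homogeneous ideal, as the first syzygy module of its quotient. -/
noncomputable def ofIdeal (hI : I.IsHomogeneous (homogeneousSubmodule (Fin n) K))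
    (hI' : I ≠ ⊤) : SyzygyModule K n where
  rank := 1
  degree := 0
  carrier := Submodule.comap (LinearMap.proj (0 : Fin 1)) I
  graded v hv j := by
    change (if 0 ≤ j then homogeneousComponent (j - 0) (v 0) else 0) ∈ I
    rw [if_pos j.zero_le]
    exact homogeneousComponent_mem_of_mem hI hv _
  constantCoeff_eq_zero v hv a := by
    rw [Subsingleton.elim a 0]
    exact constantCoeff_eq_zero_of_mem hI hI' hv

end SyzygyModule

theorem nonempty_minimalGradedFreeResolution
    (hI : I.IsHomogeneous (homogeneousSubmodule (Fin n) K)) (hI' : I ≠ ⊤) :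
    Nonempty (MinimalGradedFreeResolution I) := by
  choose next cover hcover hker using SyzygyModule.exists_isMinimalCover (K := K) (n := n)
  let Z : ℕ → SyzygyModule K n := Nat.rec (.ofIdeal hI hI') fun _ => next
  have range_cover i : LinearMap.range (cover (Z i)) = (Z i).carrier := (hcover _).range_eq
  exact ⟨{
    rank i := (Z i).rank
    degree i := (Z i).degree
    aug := I.mkQ ∘ₗ (LinearMap.proj (0 : Fin 1) : (Fin 1 → R) →ₗ[R] R)
    d i := cover (Z i)
    aug_homogeneous v j hv := ⟨v (0 : Fin 1), isHomogeneousVector_zero_iff.1 hv (0 : Fin 1), rfl⟩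
    d_homogeneous i := (hcover (Z i)).homogeneous
    aug_surjective := I.mkQ_surjective.comp (LinearMap.proj_surjective (0 : Fin 1))
    exact_zero v :=
      (Submodule.Quotient.mk_eq_zero I).trans (SetLike.ext_iff.1 (range_cover 0) v).symm
    exact_succ i := LinearMap.exact_iff.2 ((hker (Z i)).trans (range_cover (i + 1)).symm)
    minimal i v a := mem_idealOfVars_iff_constantCoeff.2 <|
      (Z i).constantCoeff_eq_zero _ ((range_cover i).le ⟨v, rfl⟩) a }⟩

end Existence

section Resolutions

variable {K : Type*} [Field K] {n : ℕ} {I : Ideal (MvPolynomial (Fin n) K)}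

local notation "R" => MvPolynomial (Fin n) K

namespace MinimalGradedFreeResolution

theorem betti_ne_zero_iff (𝓕 : MinimalGradedFreeResolution I) {i j : ℕ} :
    𝓕.betti i j ≠ 0 ↔ j ∈ Set.range (𝓕.degree i) := by
  simp [betti, Finset.filter_eq_empty_iff]

theorem isMinimalCover_d (𝓕 : MinimalGradedFreeResolution I) (i : ℕ) :
    IsMinimalCover (𝓕.degree (i + 1)) (𝓕.degree i) (LinearMap.range (𝓕.d i)) (𝓕.d i) where
  homogeneous := 𝓕.d_homogeneous i
  range_eq := rfl
  constantCoeff_eq_zero v hv a := by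
    obtain ⟨u, rfl⟩ := (𝓕.exact_succ i v).1 hv
    exact mem_idealOfVars_iff_constantCoeff.1 (𝓕.minimal (i + 1) u a)

theorem isLeast_betti_succ_iff (𝓕 : MinimalGradedFreeResolution I) {i d : ℕ} :
    IsLeast {j | 𝓕.betti (i + 1) j ≠ 0} d ↔
      IsLeast (degreeSet (𝓕.degree i) (LinearMap.range (𝓕.d i))) d := by
  simp only [betti_ne_zero_iff]
  exact (𝓕.isMinimalCover_d i).isLeast_range_degree_iff

theorem constantCoeff_eq_zero_of_aug_eq_zero (𝓕 : MinimalGradedFreeResolution I)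
    {v : Fin (𝓕.rank 0) → R} (hv : 𝓕.aug v = 0) (a : Fin (𝓕.rank 0)) :
    constantCoeff (v a) = 0 := by
  obtain ⟨u, rfl⟩ := (𝓕.exact_zero v).1 hv
  exact mem_idealOfVars_iff_constantCoeff.1 (𝓕.minimal 0 u a)

-- If `aug v = 1` and `aug eₐ = p`, then the kernel of `aug` contains `eₐ - p • v`.
theorem exists_isHomogeneous_aug_single_eq (𝓕 : MinimalGradedFreeResolution I)
    (a : Fin (𝓕.rank 0)) :
    ∃ p : R, p.IsHomogeneous (𝓕.degree 0 a) ∧ constantCoeff p ≠ 0 ∧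
      𝓕.aug (Pi.single a 1) = I.mkQ p := by
  obtain ⟨v, hv⟩ := 𝓕.aug_surjective (I.mkQ 1)
  obtain ⟨p, hp, haug⟩ := 𝓕.aug_homogeneous _ _ (isHomogeneousVector_single (𝓕.degree 0) a)
  replace haug : 𝓕.aug (Pi.single a 1) = I.mkQ p := haug
  refine ⟨p, hp, fun hp0 => ?_, haug⟩
  have mem_ker : 𝓕.aug (Pi.single a 1 - p • v) = 0 := by
    rw [map_sub, map_smul, haug, hv, ← map_smul, smul_eq_mul, mul_one, sub_self]
  simpa [hp0] using 𝓕.constantCoeff_eq_zero_of_aug_eq_zero mem_ker a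

theorem degree_zero (𝓕 : MinimalGradedFreeResolution I) : 𝓕.degree 0 = 0 := by
  ext a
  obtain ⟨p, hp, hp0, -⟩ := 𝓕.exists_isHomogeneous_aug_single_eq a
  simpa using (isHomogeneous_iff_degree_eq.1 hp 0 hp0).symm

theorem exists_isUnit_aug_single_eq (𝓕 : MinimalGradedFreeResolution I)
    (a : Fin (𝓕.rank 0)) : ∃ p : R, IsUnit p ∧ 𝓕.aug (Pi.single a 1) = I.mkQ p := by
  obtain ⟨p, hp, hp0, haug⟩ := 𝓕.exists_isHomogeneous_aug_single_eq a
  rw [degree_zero, Pi.zero_apply, ← totalDegree_zero_iff_isHomogeneous,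
    totalDegree_eq_zero_iff_eq_C] at hp
  exact ⟨p, hp ▸ hp0.isUnit.map C, haug⟩

-- If `aug eₐ = p` and `aug e_b = q`, then the kernel of `aug` contains `q • eₐ - p • e_b`.
theorem subsingleton_fin_rank_zero (𝓕 : MinimalGradedFreeResolution I) :
    Subsingleton (Fin (𝓕.rank 0)) := by
  refine ⟨fun a b => by_contra fun hab => ?_⟩
  obtain ⟨p, -, -, hp⟩ := 𝓕.exists_isHomogeneous_aug_single_eq a
  obtain ⟨q, -, hq0, hq⟩ := 𝓕.exists_isHomogeneous_aug_single_eq b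
  have mem_ker : 𝓕.aug (q • Pi.single a 1 - p • Pi.single b 1) = 0 := by
    rw [map_sub, map_smul, map_smul, hp, hq, ← map_smul, ← map_smul, smul_eq_mul, smul_eq_mul,
      mul_comm, sub_self]
  exact hq0 (by simpa [hab] using 𝓕.constantCoeff_eq_zero_of_aug_eq_zero mem_ker a)

theorem nonempty_fin_rank_zero (𝓕 : MinimalGradedFreeResolution I) (hI : I ≠ ⊤) :
    Nonempty (Fin (𝓕.rank 0)) := by
  by_contra h
  rw [not_nonempty_iff] at h
  have := Ideal.Quotient.nontrivial_iff.2 hI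
  exact not_subsingleton (R ⧸ I) 𝓕.aug_surjective.subsingleton

theorem aug_eq_zero_iff (𝓕 : MinimalGradedFreeResolution I) {v : Fin (𝓕.rank 0) → R} :
    𝓕.aug v = 0 ↔ ∀ a, v a ∈ I := by
  have := 𝓕.subsingleton_fin_rank_zero
  obtain hempty | ⟨⟨a⟩⟩ := isEmpty_or_nonempty (Fin (𝓕.rank 0))
  · simp [Subsingleton.elim v 0]
  obtain ⟨p, hp, haug⟩ := 𝓕.exists_isUnit_aug_single_eq a
  have eq_smul_single : v = v a • Pi.single a 1 := by
    ext b : 1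
    simp [Subsingleton.elim b a]
  rw [eq_smul_single, map_smul, haug, ← map_smul, Submodule.mkQ_apply,
    Submodule.Quotient.mk_eq_zero, smul_eq_mul, Ideal.mul_unit_mem_iff_mem _ hp,
    ← eq_smul_single]
  exact ⟨fun h b => Subsingleton.elim a b ▸ h, fun h => h a⟩

theorem range_d_zero (𝓕 : MinimalGradedFreeResolution I) :
    LinearMap.range (𝓕.d 0) = Submodule.pi Set.univ fun _ => I := by
  ext v
  simp only [Submodule.mem_pi, Set.mem_univ, true_imp_iff, ← 𝓕.aug_eq_zero_iff]
  exact (𝓕.exact_zero v).symm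

end MinimalGradedFreeResolution

end Resolutions

section MonomialIdeals

attribute [local instance] gradedAlgebra

variable {K : Type*} [Field K] {n s t : ℕ}

local notation "R" => MvPolynomial (Fin n) K

/-- The ideal generated by the monomials with exponents in `S`. -/
noncomputable def monomialIdeal (K : Type*) [Field K] {n : ℕ} (S : Set (Fin n →₀ ℕ)) :
    Ideal (MvPolynomial (Fin n) K) :=
  Ideal.span ((fun u => monomial u 1) '' S)

theorem isHomogeneous_monomialIdeal (S : Set (Fin n →₀ ℕ)) :
    (monomialIdeal K S).IsHomogeneous (homogeneousSubmodule (Fin n) K) := by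
  refine Ideal.homogeneous_span _ _ ?_
  rintro _ ⟨u, -, rfl⟩
  exact ⟨u.degree, isHomogeneous_monomial 1 rfl⟩

theorem monomialIdeal_ne_top {S : Set (Fin n →₀ ℕ)} (hS : 0 ∉ S) : monomialIdeal K S ≠ ⊤ := by
  rw [Ne, Ideal.eq_top_iff_one, monomialIdeal, mem_ideal_span_monomial_image]
  intro h
  obtain ⟨u, hu, hu0⟩ := h 0 (by simp)
  exact hS (nonpos_iff_eq_zero.1 hu0 ▸ hu)

theorem finite_of_isAntichain_finsupp {S : Set (Fin n →₀ ℕ)} (hS : IsAntichain (· ≤ ·) S) :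
    S.Finite :=
  hS.finite_of_partiallyWellOrderedOn (Set.isPWO_of_wellQuasiOrderedLE S)

/-- The map `⨁ₖ R(-|uₖ|) → Rᵗ` sending the `k`-th basis vector to `(x^uₖ, …, x^uₖ)`. For
`t = 1` it presents the ideal generated by the monomials `x^uₖ`; a variable `t` is allowed because
the rank of the module `F₀` of a resolution is only propositionally equal to `1`. -/
noncomputable def monomialPresentation (K : Type*) [Field K] {n s : ℕ} (t : ℕ)
    (u : Fin s → Fin n →₀ ℕ) : (Fin s → MvPolynomial (Fin n) K) →ₗ[MvPolynomial (Fin n) K]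
      (Fin t → MvPolynomial (Fin n) K) :=
  Fintype.linearCombination _ fun k _ => monomial (u k) 1

theorem monomialPresentation_apply (u : Fin s → Fin n →₀ ℕ) (v : Fin s → R) (a : Fin t) :
    monomialPresentation K t u v a = ∑ k, v k * monomial (u k) 1 := by
  simp [monomialPresentation, Fintype.linearCombination_apply]

theorem isHomogeneousMap_monomialPresentation (u : Fin s → Fin n →₀ ℕ) :
    IsHomogeneousMap (fun k => (u k).degree) 0 (monomialPresentation K t u) :=
  isHomogeneousMap_linearCombination fun _ =>
    isHomogeneousVector_zero_iff.2 fun _ => isHomogeneous_monomial 1 rfl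

theorem range_monomialPresentation [Subsingleton (Fin t)] [Nonempty (Fin t)]
    (u : Fin s → Fin n →₀ ℕ) :
    LinearMap.range (monomialPresentation K t u) =
      Submodule.pi Set.univ fun _ => monomialIdeal K (Set.range u) := by
  obtain ⟨a⟩ := ‹Nonempty (Fin t)›
  ext w
  have mem_pi_iff : w ∈ Submodule.pi Set.univ (fun _ => monomialIdeal K (Set.range u)) ↔
      w a ∈ monomialIdeal K (Set.range u) :=
    ⟨fun h => h a trivial, fun h b _ => Subsingleton.elim a b ▸ h⟩
  rw [mem_pi_iff, monomialIdeal, ← Set.range_comp, Ideal.span,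
    Submodule.mem_span_range_iff_exists_fun]
  refine exists_congr fun v => ⟨fun h => ?_, fun h => funext fun b => ?_⟩
  · rw [← h, monomialPresentation_apply]
    rfl
  · rw [Subsingleton.elim b a, monomialPresentation_apply]
    exact h

theorem coeff_sum_mul_monomial (u : Fin s → Fin n →₀ ℕ) (v : Fin s → R) (m : Fin n →₀ ℕ) :
    (∑ k, v k * monomial (u k) 1).coeff m =
      ∑ k, if u k ≤ m then (v k).coeff (m - u k) else 0 := by
  simp [coeff_sum, coeff_mul_monomial']

theorem isMinimalCover_monomialPresentation [Subsingleton (Fin t)] [Nonempty (Fin t)]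
    {u : Fin s → Fin n →₀ ℕ} (hu : Pairwise fun k l => ¬ u k ≤ u l) :
    IsMinimalCover (fun k => (u k).degree) 0
      (Submodule.pi Set.univ fun _ => monomialIdeal K (Set.range u))
      (monomialPresentation K t u) where
  homogeneous := isHomogeneousMap_monomialPresentation u
  range_eq := range_monomialPresentation u
  constantCoeff_eq_zero v hv k := by
    obtain ⟨a⟩ := ‹Nonempty (Fin t)›
    have coeff_eq_zero := congrArg (coeff (u k)) (congrFun (LinearMap.mem_ker.1 hv) a)
    rw [monomialPresentation_apply, coeff_sum_mul_monomial,
      Finset.sum_eq_single k (fun l _ hl => if_neg (hu hl)) (by simp)] at coeff_eq_zero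
    simpa [constantCoeff_eq] using coeff_eq_zero

theorem exists_degree_sup_le [Nonempty (Fin t)] {u : Fin s → Fin n →₀ ℕ} {v : Fin s → R} {j : ℕ}
    (hv : v ∈ LinearMap.ker (monomialPresentation K t u)) (hv0 : v ≠ 0)
    (hvj : IsHomogeneousVector (fun k => (u k).degree) v j) :
    ∃ k l, k ≠ l ∧ (u k ⊔ u l).degree ≤ j := by
  obtain ⟨a⟩ := ‹Nonempty (Fin t)›
  obtain ⟨k, hk⟩ := Function.ne_iff.1 hv0
  obtain ⟨m, hm⟩ := ne_zero_iff.1 hk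
  have coeff_eq_zero := congrArg (coeff (m + u k)) (congrFun (LinearMap.mem_ker.1 hv) a)
  rw [monomialPresentation_apply, coeff_sum_mul_monomial] at coeff_eq_zero
  -- The `k`-th term of this coefficient is cancelled by another one.
  obtain ⟨l, hlk, hl⟩ : ∃ l, l ≠ k ∧ u l ≤ m + u k := by
    by_contra! h
    rw [Finset.sum_eq_single k (fun l _ hl => if_neg (h l hl)) (by simp)] at coeff_eq_zero
    simp [hm] at coeff_eq_zero
  refine ⟨k, l, hlk.symm, ?_⟩
  rw [← hvj k m hm, ← map_add]
  exact Finsupp.degree_mono (sup_le le_add_self hl)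

theorem degree_sup_mem_degreeSet_ker (u : Fin s → Fin n →₀ ℕ) {k l : Fin s} (hkl : k ≠ l) :
    (u k ⊔ u l).degree ∈ degreeSet (fun k => (u k).degree)
      (LinearMap.ker (monomialPresentation K t u)) := by
  have isHomogeneousVector_smul_single (a : Fin s) (m : Fin n →₀ ℕ) (c : K) :
      IsHomogeneousVector (fun k => (u k).degree) (monomial m c • (Pi.single a 1 : Fin s → R))
        (m + u a).degree := by
    rw [map_add]
    exact (isHomogeneousVector_single _ a).smul (isHomogeneous_monomial c rfl)
  have sub_add_k : u k ⊔ u l - u k + u k = u k ⊔ u l := tsub_add_cancel_of_le le_sup_left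
  have sub_add_l : u k ⊔ u l - u l + u l = u k ⊔ u l := tsub_add_cancel_of_le le_sup_right
  refine ⟨monomial (u k ⊔ u l - u k) (1 : K) • (Pi.single k 1 : Fin s → R) +
    monomial (u k ⊔ u l - u l) (-1 : K) • (Pi.single l 1 : Fin s → R),
    ?_, fun h => ?_, .add ?_ ?_⟩
  · ext a : 1
    rw [map_add, map_smul, map_smul, monomialPresentation,
      Fintype.linearCombination_apply_single, Fintype.linearCombination_apply_single]
    simp [monomial_mul, sub_add_k, sub_add_l]
  · simpa [hkl] using congrFun h k
  · simpa only [sub_add_k] using isHomogeneousVector_smul_single k (u k ⊔ u l - u k) 1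
  · simpa only [sub_add_l] using isHomogeneousVector_smul_single l (u k ⊔ u l - u l) (-1)

theorem isLeast_degreeSet_ker_monomialPresentation_iff [Nonempty (Fin t)]
    {u : Fin s → Fin n →₀ ℕ} {d : ℕ} :
    IsLeast (degreeSet (fun k => (u k).degree) (LinearMap.ker (monomialPresentation K t u))) d ↔
      IsLeast {j | ∃ k l, k ≠ l ∧ (u k ⊔ u l).degree = j} d := by
  refine (isLeast_iff_of_subset_of_isCoinitialFor ?_ ?_).symm
  · rintro _ ⟨k, l, hkl, rfl⟩
    exact degree_sup_mem_degreeSet_ker u hkl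
  · rintro j ⟨v, hv, hv0, hvj⟩
    obtain ⟨k, l, hkl, hle⟩ := exists_degree_sup_le hv hv0 hvj
    exact ⟨_, ⟨k, l, hkl, rfl⟩, hle⟩

theorem exists_fin_enumeration_of_isAntichain {S : Set (Fin n →₀ ℕ)}
    (hS : IsAntichain (· ≤ ·) S) :
    ∃ (s : ℕ) (u : Fin s ↪ (Fin n →₀ ℕ)), Set.range u = S ∧ Pairwise fun k l => ¬ u k ≤ u l := by
  obtain ⟨s, u, rfl⟩ := (finite_of_isAntichain_finsupp hS).fin_embedding
  exact ⟨s, u, rfl, fun k l hkl => hS ⟨k, rfl⟩ ⟨l, rfl⟩ (u.injective.ne hkl)⟩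

namespace MinimalGradedFreeResolution

variable {S : Set (Fin n →₀ ℕ)}

theorem isLeast_betti_one_monomialIdeal_iff (𝓕 : MinimalGradedFreeResolution (monomialIdeal K S))
    (hS : IsAntichain (· ≤ ·) S) (hS0 : 0 ∉ S) {d : ℕ} :
    IsLeast {j | 𝓕.betti 1 j ≠ 0} d ↔ IsLeast (Finsupp.degree '' S) d := by
  have := 𝓕.subsingleton_fin_rank_zero
  have := 𝓕.nonempty_fin_rank_zero (monomialIdeal_ne_top hS0)
  obtain ⟨s, u, rfl, hu⟩ := exists_fin_enumeration_of_isAntichain hS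
  rw [isLeast_betti_succ_iff, range_d_zero, degree_zero,
    ← (isMinimalCover_monomialPresentation hu).isLeast_range_degree_iff, ← Set.range_comp]
  rfl

theorem isLeast_betti_two_monomialIdeal_iff (𝓕 : MinimalGradedFreeResolution (monomialIdeal K S))
    (hS : IsAntichain (· ≤ ·) S) (hS0 : 0 ∉ S) {d : ℕ} :
    IsLeast {j | 𝓕.betti 2 j ≠ 0} d ↔
      IsLeast {j | ∃ u ∈ S, ∃ v ∈ S, u ≠ v ∧ (u ⊔ v).degree = j} d := by
  have := 𝓕.subsingleton_fin_rank_zero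
  have := 𝓕.nonempty_fin_rank_zero (monomialIdeal_ne_top hS0)
  obtain ⟨s, u, rfl, hu⟩ := exists_fin_enumeration_of_isAntichain hS
  have isMinimalCover_d_zero := 𝓕.isMinimalCover_d 0
  rw [range_d_zero, degree_zero] at isMinimalCover_d_zero
  rw [isLeast_betti_succ_iff, ← LinearMap.exact_iff.1 (𝓕.exact_succ 0),
    isMinimalCover_d_zero.degreeSet_ker_eq (isMinimalCover_monomialPresentation hu),
    isLeast_degreeSet_ker_monomialPresentation_iff]
  simp only [Set.exists_range_iff, u.injective.ne_iff]

end MinimalGradedFreeResolution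

end MonomialIdeals

section SquarefreeExponents

variable {α : Type*}

/-- The exponent of the squarefree monomial `∏ i ∈ σ, X i`. -/
noncomputable def squarefreeExponent (σ : Finset α) : α →₀ ℕ :=
  ∑ i ∈ σ, Finsupp.single i 1

theorem prod_X_eq_monomial {A : Type*} [CommSemiring A] (σ : Finset α) :
    ∏ i ∈ σ, (X i : MvPolynomial α A) = monomial (squarefreeExponent σ) 1 :=
  (monomial_sum_one σ _).symm

theorem degree_squarefreeExponent (σ : Finset α) : (squarefreeExponent σ).degree = σ.card := by
  simp [squarefreeExponent]

theorem squarefreeExponent_apply [DecidableEq α] (σ : Finset α) (i : α) :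
    squarefreeExponent σ i = if i ∈ σ then 1 else 0 := by
  simp [squarefreeExponent, Finsupp.finsetSum_apply, Finsupp.single_apply]

theorem squarefreeExponent_le_iff {σ τ : Finset α} :
    squarefreeExponent σ ≤ squarefreeExponent τ ↔ σ ⊆ τ := by
  classical
  refine forall_congr' fun i => ?_
  rw [squarefreeExponent_apply, squarefreeExponent_apply]
  split_ifs <;> simp [*]

theorem squarefreeExponent_injective :
    Function.Injective (squarefreeExponent (α := α)) := fun _ _ h =>
  (squarefreeExponent_le_iff.1 h.le).antisymm (squarefreeExponent_le_iff.1 h.ge)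

theorem squarefreeExponent_union [DecidableEq α] (σ τ : Finset α) :
    squarefreeExponent (σ ∪ τ) = squarefreeExponent σ ⊔ squarefreeExponent τ := by
  ext i
  simp only [Finsupp.sup_apply, squarefreeExponent_apply, Finset.mem_union]
  split_ifs <;> simp_all

end SquarefreeExponents

section GeneralizedHammingWeights

variable {F : Type*} [Field F] {n : ℕ} {C : Submodule F (Fin n → F)}

theorem mem_wordSupport {c : Fin n → F} {i : Fin n} : i ∈ wordSupport c ↔ c i ≠ 0 := by
  simp [wordSupport]

theorem wordSupport_nonempty {c : Fin n → F} (hc : c ≠ 0) : (wordSupport c).Nonempty :=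
  (Function.ne_iff.1 hc).imp fun _ => mem_wordSupport.2

theorem wordSupport_smul {a : F} (ha : a ≠ 0) (c : Fin n → F) :
    wordSupport (a • c) = wordSupport c := by
  ext i
  simp [mem_wordSupport, ha]

theorem mem_spaceSupport_span {s : Set (Fin n → F)} {i : Fin n} :
    i ∈ spaceSupport (Submodule.span F s) ↔ ∃ c ∈ s, i ∈ wordSupport c := by
  refine ⟨fun ⟨c, hc, hi⟩ => ?_, fun ⟨c, hc, hi⟩ => ⟨c, Submodule.subset_span hc, hi⟩⟩
  by_contra! h
  have span_le : Submodule.span F s ≤ LinearMap.ker (LinearMap.proj i) :=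
    Submodule.span_le.2 fun c' hc' => by simpa [mem_wordSupport] using h c' hc'
  exact mem_wordSupport.1 hi (span_le hc)

theorem spaceWeight_span_singleton (c : Fin n → F) :
    spaceWeight (Submodule.span F {c}) = wordWeight c := by
  rw [spaceWeight, wordWeight, ← Set.ncard_coe_finset]
  congr 1
  ext i
  simp [mem_spaceSupport_span]

theorem spaceWeight_span_pair (c₁ c₂ : Fin n → F) :
    spaceWeight (Submodule.span F {c₁, c₂}) = (wordSupport c₁ ∪ wordSupport c₂).card := by
  rw [spaceWeight, ← Set.ncard_coe_finset]
  congr 1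
  ext i
  simp [mem_spaceSupport_span]

theorem generalizedHammingWeight_one (C : Submodule F (Fin n → F)) :
    generalizedHammingWeight C 1 = minimumWeight C := by
  refine congrArg sInf (Set.ext fun w => ⟨?_, ?_⟩)
  · rintro ⟨D, hD, hrank, rfl⟩
    obtain ⟨c, hc, hc0⟩ := D.exists_mem_ne_zero_of_ne_bot (by rintro rfl; simp at hrank)
    have span_eq : Submodule.span F {c} = D := Submodule.eq_of_le_of_finrank_eq
      (by rwa [Submodule.span_singleton_le_iff_mem]) (by rw [finrank_span_singleton hc0, hrank])
    exact ⟨c, hD hc, hc0, by rw [← span_eq, spaceWeight_span_singleton]⟩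
  · rintro ⟨c, hc, hc0, rfl⟩
    exact ⟨Submodule.span F {c}, by rwa [Submodule.span_singleton_le_iff_mem],
      finrank_span_singleton hc0, spaceWeight_span_singleton c⟩

theorem finrank_span_pair_eq_two_iff {V : Type*} [AddCommGroup V] [Module F V] {x y : V} :
    Module.finrank F (Submodule.span F {x, y}) = 2 ↔ LinearIndependent F ![x, y] := by
  rw [linearIndependent_iff_card_eq_finrank_span, Matrix.range_cons_cons_empty, Set.finrank,
    Fintype.card_fin, eq_comm]

end GeneralizedHammingWeights

section MinimalSupports

variable {F : Type*} [Field F] {n : ℕ} {C : Submodule F (Fin n → F)} {M : Set (Fin n → F)}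

theorem minimumWeight_le {c : Fin n → F} (hc : c ∈ C) (hc0 : c ≠ 0) :
    minimumWeight C ≤ wordWeight c :=
  Nat.sInf_le ⟨c, hc, hc0, rfl⟩

-- Subtracting a multiple of `c₁` from `c₂` removes a position from the support of `c₂`.
theorem wordSupport_eq_iff_exists_smul_eq {c₁ c₂ : Fin n → F}
    (h₁ : c₁ ∈ minimalSupportCodewords C) (h₂ : c₂ ∈ minimalSupportCodewords C) :
    wordSupport c₁ = wordSupport c₂ ↔ ∃ a : F, a • c₁ = c₂ := by
  constructor
  · intro heq
    obtain ⟨i, hi⟩ := wordSupport_nonempty h₁.2.1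
    have hi₂ : i ∈ wordSupport c₂ := heq ▸ hi
    refine ⟨c₂ i / c₁ i, (sub_eq_zero.1 (by_contra fun hne => ?_)).symm⟩
    refine h₂.2.2 _ (C.sub_mem h₂.1 (C.smul_mem _ h₁.1)) hne ?_
    refine (Finset.ssubset_iff_of_subset fun k hk => ?_).2 ⟨i, hi₂, ?_⟩
    · contrapose! hk
      have hk₁ : k ∉ wordSupport c₁ := heq ▸ hk
      rw [mem_wordSupport, not_not] at hk hk₁
      simp [mem_wordSupport, hk, hk₁]
    · simp [mem_wordSupport, div_mul_cancel₀ _ (mem_wordSupport.1 hi)]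
  · rintro ⟨a, rfl⟩
    exact (wordSupport_smul (left_ne_zero_of_smul h₂.2.1) c₁).symm

theorem finrank_span_pair_eq_two_iff_wordSupport_ne {c₁ c₂ : Fin n → F}
    (h₁ : c₁ ∈ minimalSupportCodewords C) (h₂ : c₂ ∈ minimalSupportCodewords C) :
    Module.finrank F (Submodule.span F {c₁, c₂}) = 2 ↔ wordSupport c₁ ≠ wordSupport c₂ := by
  rw [finrank_span_pair_eq_two_iff, LinearIndependent.pair_iff' h₁.2.1, Ne,
    wordSupport_eq_iff_exists_smul_eq h₁ h₂, not_exists]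

theorem isAntichain_supportSet (hM : M ⊆ minimalSupportCodewords C) :
    IsAntichain (· ⊆ ·) (supportSet M) := by
  rintro _ ⟨c₁, h₁, rfl⟩ _ ⟨c₂, h₂, rfl⟩ hne hle
  exact (hM h₂).2.2 c₁ (hM h₁).1 (hM h₁).2.1 (hle.ssubset_of_ne hne)

theorem empty_notMem_supportSet (hM : M ⊆ minimalSupportCodewords C) : ∅ ∉ supportSet M := by
  rintro ⟨c, hc, h0⟩
  exact (wordSupport_nonempty (hM hc).2.1).ne_empty h0

theorem generalizedHammingWeight_two_le (hM : M ⊆ minimalSupportCodewords C)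
    {σ τ : Finset (Fin n)} (hσ : σ ∈ supportSet M) (hτ : τ ∈ supportSet M) (hne : σ ≠ τ) :
    generalizedHammingWeight C 2 ≤ (σ ∪ τ).card := by
  obtain ⟨c₁, h₁, rfl⟩ := hσ
  obtain ⟨c₂, h₂, rfl⟩ := hτ
  refine Nat.sInf_le ⟨Submodule.span F {c₁, c₂}, Submodule.span_le.2 ?_,
    (finrank_span_pair_eq_two_iff_wordSupport_ne (hM h₁) (hM h₂)).2 hne,
    spaceWeight_span_pair c₁ c₂⟩
  rintro c (rfl | rfl)
  exacts [(hM h₁).1, (hM h₂).1]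

theorem isD2TestSet_iff (hM : M ⊆ minimalSupportCodewords C) :
    IsD2TestSet C M ↔ ∃ σ ∈ supportSet M, ∃ τ ∈ supportSet M, σ ≠ τ ∧
      (σ ∪ τ).card = generalizedHammingWeight C 2 := by
  constructor
  · rintro ⟨-, c₁, h₁, c₂, h₂, hrank, hw⟩
    exact ⟨_, ⟨c₁, h₁, rfl⟩, _, ⟨c₂, h₂, rfl⟩,
      (finrank_span_pair_eq_two_iff_wordSupport_ne (hM h₁) (hM h₂)).1 hrank,
      (spaceWeight_span_pair c₁ c₂).symm.trans hw⟩
  · rintro ⟨_, ⟨c₁, h₁, rfl⟩, _, ⟨c₂, h₂, rfl⟩, hne, hw⟩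
    exact ⟨hM, c₁, h₁, c₂, h₂,
      (finrank_span_pair_eq_two_iff_wordSupport_ne (hM h₁) (hM h₂)).2 hne,
      (spaceWeight_span_pair c₁ c₂).trans hw⟩

end MinimalSupports

section SupportIdeals

variable {F : Type*} [Field F] {n : ℕ} {C : Submodule F (Fin n → F)} {K : Type*} [Field K]
  {M : Set (Fin n → F)}

theorem supportIdeal_eq_monomialIdeal :
    supportIdeal K M = monomialIdeal K (squarefreeExponent '' supportSet M) := by
  rw [supportIdeal, monomialIdeal, Set.image_image]
  congr 1
  ext f
  change (∃ σ ∈ supportSet M, f = _) ↔ _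
  simp only [Set.mem_image, prod_X_eq_monomial, eq_comm]

theorem image_degree_squarefreeExponent_image_supportSet :
    Finsupp.degree '' (squarefreeExponent '' supportSet M) = wordWeight '' M := by
  simp only [Set.image_image, degree_squarefreeExponent]
  exact Set.image_image Finset.card wordSupport M

theorem isAntichain_squarefreeExponent_image (hM : M ⊆ minimalSupportCodewords C) :
    IsAntichain (· ≤ ·) (squarefreeExponent '' supportSet M) :=
  (isAntichain_supportSet hM).image _ fun _ _ => squarefreeExponent_le_iff.1

theorem zero_notMem_squarefreeExponent_image (hM : M ⊆ minimalSupportCodewords C) :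
    0 ∉ squarefreeExponent '' supportSet M := by
  rintro ⟨σ, hσ, h0⟩
  obtain rfl : σ = ∅ := squarefreeExponent_injective h0
  exact empty_notMem_supportSet hM hσ

end SupportIdeals

theorem theorem6p2_general {F : Type*} [Field F] {n : ℕ} (C : Submodule F (Fin n → F))
    (K : Type*) [Field K] (M : Set (Fin n → F)) (hM : M ⊆ minimalSupportCodewords C) :
    Nonempty (MinimalGradedFreeResolution (supportIdeal K M)) ∧
    ∀ 𝓕 : MinimalGradedFreeResolution (supportIdeal K M),
      (IsLeast {j | 𝓕.betti 1 j ≠ 0} (generalizedHammingWeight C 1) ↔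
        ∃ c ∈ M, wordWeight c = minimumWeight C) ∧
      (IsLeast {j | 𝓕.betti 2 j ≠ 0} (generalizedHammingWeight C 2) ↔ IsD2TestSet C M) := by
  have hS := isAntichain_squarefreeExponent_image hM
  have hS0 := zero_notMem_squarefreeExponent_image hM
  rw [supportIdeal_eq_monomialIdeal]
  refine ⟨nonempty_minimalGradedFreeResolution (isHomogeneous_monomialIdeal _)
    (monomialIdeal_ne_top hS0), fun 𝓕 => ⟨?_, ?_⟩⟩
  · rw [𝓕.isLeast_betti_one_monomialIdeal_iff hS hS0, generalizedHammingWeight_one,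
      image_degree_squarefreeExponent_image_supportSet]
    refine and_iff_left ?_
    rintro _ ⟨c, hc, rfl⟩
    exact minimumWeight_le (hM hc).1 (hM hc).2.1
  · rw [𝓕.isLeast_betti_two_monomialIdeal_iff hS hS0, isD2TestSet_iff hM]
    simp only [Set.exists_mem_image, squarefreeExponent_injective.ne_iff,
      ← squarefreeExponent_union, degree_squarefreeExponent]
    refine and_iff_left ?_
    rintro _ ⟨σ, hσ, τ, hτ, hne, rfl⟩
    exact generalizedHammingWeight_two_le hM hσ hτ hne

theorem theorem6p2 {F : Type*} [Field F] [Finite F] {n : ℕ} (C : Submodule F (Fin n → F))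
    (K : Type*) [Field K] (M : Set (Fin n → F)) (hM : M ⊆ minimalSupportCodewords C)
    (hS : 2 ≤ (supportSet M).ncard) :
    Nonempty (MinimalGradedFreeResolution (supportIdeal K M)) ∧
    ∀ 𝓕 : MinimalGradedFreeResolution (supportIdeal K M),
      (IsLeast {j | 𝓕.betti 1 j ≠ 0} (generalizedHammingWeight C 1) ↔
        ∃ c ∈ M, wordWeight c = minimumWeight C) ∧
      (IsLeast {j | 𝓕.betti 2 j ≠ 0} (generalizedHammingWeight C 2) ↔ IsD2TestSet C M) :=
  theorem6p2_general C K M hM
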